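/- Let $K$ be $\mathbb R$ or $\mathbb C$, let $n\ge 5$, and let $P_0,\dots,P_{n-1}\in K^3$ be distinct points such that $P_0,P_1,P_2,P_3$ form an affine basis. The affine-invariant coordinates $(\alpha_i,\beta_i,\gamma_i)_{4\le i\le n-1}$ of such a configuration are defined by $P_i=\alpha_iP_0+\beta_iP_1+\gamma_iP_2+(1-\alpha_i-\beta_i-\gamma_i)P_3$. Let $C$ be a fixed pinhole camera, i.e. a $3\times4$ matrix whose left $3\times 3$ block is invertible; a nonzero vector $q\in K^3$ is an image of the point $P$ if $q$ is a nonzero scalar multiple of $C\binom P1$. Let $T_1,T_2$ be two arbitrary invertible affine deformations of $K^3$, in particular two unrelated generic ones, and let $q_i,q_i',q_i''$ be images of $P_i$, $T_1P_i$ and $T_2T_1P_i$, respectively, for $0\le i\le n-1$ (so none of these points is the camera centre). Then the affine-invariant coordinates are not determined by the three images up to a finite ambiguity, even if $C$ is known. More precisely, let $S\subset K^{3(n-4)}$ be the set of all coordinates $(\alpha_i,\beta_i,\gamma_i)_{4\le i\le n-1}$ of configurations $\hat P_0,\dots,\hat P_{n-1}$ of distinct points, with $\hat P_0,\dots,\hat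 P_3$ an affine basis, for which there are invertible affine deformations $\hat T_1,\hat T_2$ such that $q_i,q_i',q_i''$ are images of $\hat P_i,\hat T_1\hat P_i,\hat T_2\hat T_1\hat P_i$ in $C$ for all $i$. Then: 1. $S$ is infinite, and for each single $i\ge4$ the set of triples $(\alpha_i,\beta_i,\gamma_i)$ occurring in $S$ is infinite. 2. The Zariski closure of $S$ has strictly positive dimension. 3. Let $X\subset\mathbb P^{11}\times\mathbb P^{11}\times\mathbb A^{8}\times\mathbb A^{3(n-4)}$ be the variety of all $([A;t],[A';t'],(\lambda_j,u_j)_{0\le j\le3},(\alpha_i,\beta_i,\gamma_i)_{4\le i\le n-1})$ such that, with $Q_j=\lambda_jq_j$ for $0\le j\le 3$ and $Q_i=\alpha_iQ_0+\beta_iQ_1+\gamma_iQ_2+(1-\alpha_i-\beta_i-\gamma_i)Q_3$ for $4\le i\le n-1$, $$\lambda_ju_j=1\ (0\le j\le 3),\qquad q_i\wedge Q_i=0\ (4\le i\le n-1),$$ $$q_i'\wedge[A;t]\tbinom{Q_i}{1}=0,\qquad q_i''\wedge[A';t']\tbinom{Q_i}{1}=0\ (0\le i\le n-1),$$ where $\wedge$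 is the cross product. Then the (Zariski closure of the) projection of $X$ to $\mathbb A^{3(n-4)}$ has strictly positive dimension. -/

import Mathlib

open scoped Matrix LinearAlgebra.Projectivization

/-- The vector `(P₁, P₂, P₃, 1)` of homogeneous coordinates of a point of affine 3-space. -/
def homog {K : Type*} [Field K] (P : Fin 3 → K) : Fin 4 → K := ![P 0, P 1, P 2, 1]

/-- A finite (pinhole) camera `C = [M; m]`: a `3 × 4` matrix whose left `3 × 3` block `M` is
invertible. -/
def IsFiniteCamera {K : Type*} [Field K] (C : Matrix (Fin 3) (Fin 4) K) : Prop :=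
  (C.submatrix id Fin.castSucc).det ≠ 0

/-- `q` is a vector of homogeneous coordinates of the image of the point `P` in the camera `C`:
`q ≠ 0` and `q` equals `C (P, 1)` up to a nonzero scalar. -/
def IsImage {K : Type*} [Field K] (C : Matrix (Fin 3) (Fin 4) K) (P q : Fin 3 → K) : Prop :=
  q ≠ 0 ∧ ∃ c : K, c ≠ 0 ∧ C *ᵥ homog P = c • q

/-- The affine combination `α p₀ + β p₁ + γ p₂ + (1 - α - β - γ) p₃`. -/
def affComb {K : Type*} [Field K] (α β γ : K) (p : Fin 4 → Fin 3 → K) : Fin 3 → K :=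
  α • p 0 + β • p 1 + γ • p 2 + (1 - α - β - γ) • p 3

/-- A configuration of `n = 4 + m` distinct points of 3-space (the points `P₀, …, P₃` are indexed
by `Sum.inl`, the remaining ones by `Sum.inr`) such that `P₀, …, P₃` is an affine basis. -/
def IsConfiguration {K : Type*} [Field K] {m : ℕ} (P : Fin 4 ⊕ Fin m → Fin 3 → K) : Prop :=
  Function.Injective P ∧ AffineIndependent K (fun j : Fin 4 => P (Sum.inl j))

/-- `x` is the family of affine-invariant coordinates
`(αᵢ, βᵢ, γᵢ) = (x (i, 0), x (i, 1), x (i, 2))` of the points `Pᵢ` that follow `P₀, …, P₃`. -/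
def HasInvariants {K : Type*} [Field K] {m : ℕ} (P : Fin 4 ⊕ Fin m → Fin 3 → K)
    (x : Fin m × Fin 3 → K) : Prop :=
  ∀ i : Fin m, P (Sum.inr i) =
    affComb (x (i, 0)) (x (i, 1)) (x (i, 2)) (fun j => P (Sum.inl j))

/-- `q`, `q'`, `q''` are the images, in the fixed camera `C`, of the points `P`, of the points
after the invertible affine deformation `T₁`, and of the points after the further invertible
affine deformation `T₂`. -/
def AreImages {K : Type*} [Field K] {m : ℕ} (C : Matrix (Fin 3) (Fin 4) K)
    (P : Fin 4 ⊕ Fin m → Fin 3 → K) (T₁ T₂ : (Fin 3 → K) ≃ᵃ[K] (Fin 3 → K))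
    (q q' q'' : Fin 4 ⊕ Fin m → Fin 3 → K) : Prop :=
  ∀ i, IsImage C (P i) (q i) ∧ IsImage C (T₁ (P i)) (q' i) ∧ IsImage C (T₂ (T₁ (P i))) (q'' i)

/-- All families of affine-invariant coordinates of configurations that can produce the three
given images in the camera `C` through some pair of invertible affine deformations. -/
def compatibleInvariants {K : Type*} [Field K] {m : ℕ} (C : Matrix (Fin 3) (Fin 4) K)
    (q q' q'' : Fin 4 ⊕ Fin m → Fin 3 → K) : Set (Fin m × Fin 3 → K) :=
  {x | ∃ (P : Fin 4 ⊕ Fin m → Fin 3 → K) (T₁ T₂ : (Fin 3 → K) ≃ᵃ[K] (Fin 3 → K)),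
    IsConfiguration P ∧ HasInvariants P x ∧ AreImages C P T₁ T₂ q q' q''}

/-- The point obtained from the first image points `q₀, …, q₃`, the scales `l₀, …, l₃` and the
affine coordinates of the `i`-th point (camera normalized to `[I; 0]`). -/
def scaledPoint {K : Type*} [Field K] {m : ℕ} (q : Fin 4 ⊕ Fin m → Fin 3 → K)
    (l : Fin 4 → K) (x : Fin m × Fin 3 → K) (i : Fin m) : Fin 3 → K :=
  affComb (x (i, 0)) (x (i, 1)) (x (i, 2)) (fun j => l j • q (Sum.inl j))

/-- The equations satisfied by the `3 × 4` matrix `M = [A; t]` that explains the image `r` taken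
after a deformation. They are homogeneous in `M`. -/
def DeformedImageEqs {K : Type*} [Field K] {m : ℕ} (q r : Fin 4 ⊕ Fin m → Fin 3 → K)
    (M : Matrix (Fin 3) (Fin 4) K) (l : Fin 4 → K) (x : Fin m × Fin 3 → K) : Prop :=
  (∀ j : Fin 4, r (Sum.inl j) ⨯₃ (M *ᵥ homog (l j • q (Sum.inl j))) = 0) ∧
  (∀ i : Fin m, r (Sum.inr i) ⨯₃ (M *ᵥ homog (scaledPoint q l x i)) = 0)

/-- The variety in `ℙ¹¹ × ℙ¹¹ × 𝔸⁴ × 𝔸⁴ × 𝔸^(3m)` of all `([A; t], [A'; t'], l, u, (α, β, γ))`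
that solve the equations of the three images, together with `lⱼ uⱼ = 1`. Here `[A; t]` and
`[A'; t']` describe the maps from the first scene to the second and to the third one. -/
def imageVariety {K : Type*} [Field K] {m : ℕ} (q q' q'' : Fin 4 ⊕ Fin m → Fin 3 → K) :
    Set (ℙ K (Matrix (Fin 3) (Fin 4) K) × ℙ K (Matrix (Fin 3) (Fin 4) K) ×
      (Fin 4 → K) × (Fin 4 → K) × (Fin m × Fin 3 → K)) :=
  {z | match z with
    | (M, N, l, u, x) =>
      (∀ i : Fin m, q (Sum.inr i) ⨯₃ scaledPoint q l x i = 0) ∧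
      DeformedImageEqs q q' M.rep l x ∧
      DeformedImageEqs q q'' N.rep l x ∧
      (∀ j : Fin 4, l j * u j = 1)}

/-- The projection of the variety of the three images to the space of the coordinates
`(αᵢ, βᵢ, γᵢ)`. -/
def projectedInvariants {K : Type*} [Field K] {m : ℕ}
    (q q' q'' : Fin 4 ⊕ Fin m → Fin 3 → K) : Set (Fin m × Fin 3 → K) :=
  (fun z => z.2.2.2.2) '' imageVariety q q' q''

/-- The dimension of (the Zariski closure of) a subset of affine space, as the Krull dimension of
its coordinate ring. -/
noncomputable def zariskiDim {K : Type*} [Field K] {σ : Type*} (S : Set (σ → K)) :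
    WithBot ℕ∞ :=
  ringKrullDim (MvPolynomial σ K ⧸ MvPolynomial.vanishingIdeal K S)

/-! The ambiguity is projective. Let `c` be the camera centre and `w` a linear form; `perspectivity
c w` moves each point along its ray through `c`, so the first image is unchanged. It is not affine,
yet for every affine `T`, `exists_affineEquiv_perspectivity` gives an affine `T'` sending the moved
`X` to the ray from `c` through `T X`. So a single `w` preserves all three images, provided `1 + w
(· - c)` vanishes at no scene point and at no preimage of `c`. The barycentric coordinates `a j` of
a point `X` become `a j * (1 + w (p j - c)) / (1 + w (X - c))` (`perspectivity_sum`). For `w` equal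
to `s` times a suitable coordinate, one of them is a nonconstant Möbius function of `s`, hence takes
infinitely many values. An infinite set has positive-dimensional closure, and every compatible
family lifts to the variety. -/

section ZariskiDimension

variable {K σ : Type*} [Field K] [Finite σ]

/-- An infinite subset of affine space has positive dimension. -/
theorem zariskiDim_pos_of_infinite {S : Set (σ → K)} (hS : S.Infinite) : 0 < zariskiDim S := by
  unfold zariskiDim
  set I := MvPolynomial.vanishingIdeal K S
  by_contra hdim
  rw [not_lt] at hdim
  have : Ring.KrullDimLE 0 (MvPolynomial σ K ⧸ I) :=
    Ring.krullDimLE_iff.mpr (by simpa using hdim)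
  have : IsArtinianRing (MvPolynomial σ K ⧸ I) :=
    isArtinianRing_iff_isNoetherianRing_krullDimLE_zero.mpr ⟨inferInstance, this⟩
  let φ : S → (MvPolynomial σ K ⧸ I →+* K) := fun p =>
    Ideal.Quotient.lift I (MvPolynomial.eval p.1) fun f hf => by
      simpa [MvPolynomial.aeval_eq_eval] using MvPolynomial.mem_vanishingIdeal_iff.mp hf p.1 p.2
  have hφ : ∀ p f, φ p (Ideal.Quotient.mk I f) = MvPolynomial.eval p.1 f := fun p f => rfl
  -- Points of `S` inject into the spectrum, which is finite for an Artinian ring.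
  let ψ : S → PrimeSpectrum (MvPolynomial σ K ⧸ I) := fun p =>
    ⟨RingHom.ker (φ p), RingHom.ker_isPrime _⟩
  have hψ : Function.Injective ψ := by
    intro p p' h
    ext j
    have hmem : Ideal.Quotient.mk I (MvPolynomial.X j - MvPolynomial.C (p.1 j)) ∈
        RingHom.ker (φ p') := by
      change _ ∈ (ψ p').asIdeal
      rw [← h]
      change φ p _ = 0
      rw [hφ]
      simp
    rw [RingHom.mem_ker, hφ] at hmem
    simpa using (sub_eq_zero.mp ((map_sub _ _ _).symm.trans hmem)).symm
  have : Infinite S := hS.to_subtype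
  exact not_finite_iff_infinite.mpr (Infinite.of_injective ψ hψ) inferInstance

end ZariskiDimension

/-! ### Perspectivities and their interplay with affine maps -/

section Perspectivity

variable {K V : Type*} [Field K] [AddCommGroup V] [Module K V]

/-- The projective transformation with centre `c` that fixes the lines through `c` and sends the
plane `1 + w (X - c) = 0` to infinity. -/
def perspectivity (c : V) (w : V →ₗ[K] K) (X : V) : V :=
  c + (1 + w (X - c))⁻¹ • (X - c)

theorem perspectivity_sub (c : V) (w : V →ₗ[K] K) (X : V) :
    perspectivity c w X - c = (1 + w (X - c))⁻¹ • (X - c) :=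
  add_sub_cancel_left _ _

/-- The scale factor can be read off from the image point, so the perspectivity can be inverted. -/
theorem one_sub_apply_perspectivity {c : V} {w : V →ₗ[K] K} {X : V} (hX : 1 + w (X - c) ≠ 0) :
    1 - w (perspectivity c w X - c) = (1 + w (X - c))⁻¹ := by
  rw [perspectivity_sub, map_smul, smul_eq_mul]
  field_simp
  ring

theorem perspectivity_injOn (c : V) (w : V →ₗ[K] K) :
    Set.InjOn (perspectivity c w) {X | 1 + w (X - c) ≠ 0} := by
  intro X hX Y hY h
  have h1 : (1 + w (X - c))⁻¹ = (1 + w (Y - c))⁻¹ := by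
    rw [← one_sub_apply_perspectivity hX, ← one_sub_apply_perspectivity hY, h]
  have h2 : (1 + w (X - c))⁻¹ • (X - c) = (1 + w (X - c))⁻¹ • (Y - c) := by
    rw [← perspectivity_sub, h, perspectivity_sub, h1]
  exact sub_left_injective (smul_right_injective V (inv_ne_zero hX) h2)

/-- Dividing the weights of a relation among the images by `1 + w (p i - c)` gives a relation among
the `p i`; applying `w` to the original relation shows that the new weights again sum to zero. -/
theorem AffineIndependent.perspectivity {ι : Type*} [Fintype ι] {c : V} {w : V →ₗ[K] K}
    {p : ι → V} (hp : AffineIndependent K p) (hw : ∀ i, 1 + w (p i - c) ≠ 0) :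
    AffineIndependent K fun i => perspectivity c w (p i) := by
  rw [affineIndependent_iff_of_fintype] at hp ⊢
  intro a ha hsum i
  rw [Finset.weightedVSub_eq_weightedVSubOfPoint_of_sum_eq_zero _ _ _ ha c,
    Finset.weightedVSubOfPoint_apply] at hsum
  simp only [vsub_eq_sub] at hsum
  have hb : ∑ i, a i * (1 + w (p i - c))⁻¹ = 0 := by
    have := congrArg w hsum
    rw [map_sum, map_zero] at this
    simp only [map_smul, smul_eq_mul] at this
    simp only [← one_sub_apply_perspectivity (hw _), mul_sub, mul_one, Finset.sum_sub_distrib, ha,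
      this, sub_zero]
  have := hp (fun i => a i * (1 + w (p i - c))⁻¹) hb (by
    rw [Finset.weightedVSub_eq_weightedVSubOfPoint_of_sum_eq_zero _ _ _ hb c,
      Finset.weightedVSubOfPoint_apply]
    simpa only [vsub_eq_sub, perspectivity_sub, smul_smul] using hsum) i
  exact (mul_eq_zero.mp this).resolve_right (inv_ne_zero (hw i))

/-- A perspectivity with centre `c` commutes, up to scaling with centre `c`, with an affine
transformation and a corrected one. -/
theorem exists_affineEquiv_perspectivity [FiniteDimensional K V] (c : V) (w : V →ₗ[K] K)
    (T : V ≃ᵃ[K] V) (hT : 1 + w (T.symm c - c) ≠ 0) :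
    ∃ T' : V ≃ᵃ[K] V, ∀ X, 1 + w (X - c) ≠ 0 →
      T' (perspectivity c w X) - c = (1 + w (X - c))⁻¹ • (T X - c) := by
  have hlin : ∀ X, T X = T.linear (X - c) + T c := fun X => by
    simpa using T.map_vadd c (X - c)
  have hTc : T.linear (T.symm c - c) = c - T c := by
    have := hlin (T.symm c)
    rw [T.apply_symm_apply] at this
    exact eq_sub_of_add_eq this.symm
  -- The rank-one term compensates for the translation part `T c - c` being scaled by `(1 + w (X -
  -- c))⁻¹`.
  let B : V →ₗ[K] V := T.linear.toLinearMap - w.smulRight (T c - c)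
  have hB : ∀ x, B x = T.linear x - w x • (T c - c) := fun x => rfl
  have hinj : Function.Injective B := by
    rw [injective_iff_map_eq_zero]
    intro x hx
    have hx' : x = -(w x) • (T.symm c - c) := by
      apply T.linear.injective
      rw [map_smul, hTc, sub_eq_zero.mp ((hB x).symm.trans hx), neg_smul, ← smul_neg, neg_sub]
    have hwx : w x * (1 + w (T.symm c - c)) = 0 := by
      have := congrArg w hx'
      rw [map_smul, smul_eq_mul] at this
      linear_combination this
    rw [hx', (mul_eq_zero.mp hwx).resolve_right hT, neg_zero, zero_smul]
  refine ⟨((AffineEquiv.constVAdd K V (-c)).trans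
    (LinearEquiv.ofInjectiveEndo B hinj).toAffineEquiv).trans (AffineEquiv.constVAdd K V (T c)),
    fun X hX => ?_⟩
  have happ : B (perspectivity c w X - c) + (T c - c) = (1 + w (X - c))⁻¹ • (T X - c) := by
    have h1 := one_sub_apply_perspectivity hX
    rw [hB, hlin X, add_sub_assoc, smul_add, ← map_smul, ← perspectivity_sub, ← h1, sub_smul,
      one_smul]
    abel
  rw [← happ]
  simp only [AffineEquiv.trans_apply, AffineEquiv.constVAdd_apply, LinearEquiv.coe_toAffineEquiv,
    LinearEquiv.coe_ofInjectiveEndo, vadd_eq_add]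
  rw [neg_add_eq_sub]
  abel

/-- The barycentric coordinates of the image of a point under a perspectivity. -/
theorem perspectivity_sum {ι : Type*} [Fintype ι] {c : V} {w : V →ₗ[K] K} {p : ι → V}
    (hw : ∀ i, 1 + w (p i - c) ≠ 0) {a : ι → K} (ha : ∑ i, a i = 1)
    (hX : 1 + w (∑ i, a i • p i - c) ≠ 0) :
    ∑ i, a i * (1 + w (p i - c)) / (1 + w (∑ i, a i • p i - c)) = 1 ∧
      perspectivity c w (∑ i, a i • p i) =
        ∑ i, (a i * (1 + w (p i - c)) / (1 + w (∑ i, a i • p i - c))) •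
          perspectivity c w (p i) := by
  have hsub : ∑ i, a i • (p i - c) = ∑ i, a i • p i - c := by
    simp only [smul_sub, Finset.sum_sub_distrib, ← Finset.sum_smul, ha, one_smul]
  have hsum : ∑ i, a i * (1 + w (p i - c)) = 1 + w (∑ i, a i • p i - c) := by
    rw [← hsub, map_sum]
    simp only [mul_add, mul_one, Finset.sum_add_distrib, ha, map_smul, smul_eq_mul]
  have h1 : ∑ i, a i * (1 + w (p i - c)) / (1 + w (∑ i, a i • p i - c)) = 1 := by
    rw [← Finset.sum_div, hsum, div_self hX]
  refine ⟨h1, ?_⟩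
  unfold perspectivity
  simp only [smul_add, Finset.sum_add_distrib, ← Finset.sum_smul, h1, one_smul]
  rw [add_right_inj, ← hsub, Finset.smul_sum]
  refine Finset.sum_congr rfl fun i _ => ?_
  rw [hsub, smul_smul, smul_smul]
  congr 1
  have := hw i
  field_simp

end Perspectivity

/-! ### Cameras, images and the equations of the variety -/

section Cameras

variable {K : Type*} [Field K]

theorem mulVec_homog (C : Matrix (Fin 3) (Fin 4) K) (X : Fin 3 → K) :
    C *ᵥ homog X = C.submatrix id Fin.castSucc *ᵥ X + fun i => C i 3 := by
  ext i
  fin_cases i <;> simp [Matrix.mulVec, dotProduct, homog, Fin.sum_univ_succ] <;> ring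

/-- A finite camera is an affine isomorphism to the space of homogeneous vectors of the image
plane. -/
theorem IsFiniteCamera.exists_affineEquiv {C : Matrix (Fin 3) (Fin 4) K} (hC : IsFiniteCamera C) :
    ∃ E : (Fin 3 → K) ≃ᵃ[K] (Fin 3 → K), ∀ X, C *ᵥ homog X = E X := by
  let M := C.submatrix id Fin.castSucc
  have hM : IsUnit M.det := isUnit_iff_ne_zero.mpr hC
  refine ⟨(M.toLinearEquiv' (M.invertibleOfIsUnitDet hM)).toAffineEquiv.trans
    (AffineEquiv.constVAdd K _ fun i => C i 3), fun X => ?_⟩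
  rw [mulVec_homog, add_comm]
  rfl

/-- Every affine map of 3-space is given by a `3 × 4` matrix. -/
theorem exists_mulVec_homog (f : (Fin 3 → K) →ᵃ[K] (Fin 3 → K)) :
    ∃ N : Matrix (Fin 3) (Fin 4) K, ∀ X, N *ᵥ homog X = f X := by
  refine ⟨Matrix.of fun i =>
    (Fin.snoc (fun j => LinearMap.toMatrix' f.linear i j) (f 0 i) : Fin 4 → K), fun X => ?_⟩
  rw [mulVec_homog, congrFun f.decomp X, Pi.add_apply, ← LinearMap.toMatrix'_mulVec f.linear X]
  rfl

theorem affComb_eq_sum (α β γ : K) (p : Fin 4 → Fin 3 → K) :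
    affComb α β γ p = ∑ j, (![α, β, γ, 1 - α - β - γ] : Fin 4 → K) j • p j := by
  simp [affComb, Fin.sum_univ_four]

theorem map_affComb (f : (Fin 3 → K) →ᵃ[K] (Fin 3 → K)) (α β γ : K) (p : Fin 4 → Fin 3 → K) :
    f (affComb α β γ p) = affComb α β γ fun j => f (p j) := by
  rw [f.decomp]
  simp only [affComb, map_add, map_smul, Pi.add_apply]
  module

theorem sum_barycentric (α β γ : K) :
    ∑ j, (![α, β, γ, 1 - α - β - γ] : Fin 4 → K) j = 1 := by
  simp [Fin.sum_univ_four]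

theorem barycentric_eq {a : Fin 4 → K} (ha : ∑ j, a j = 1) :
    ![a 0, a 1, a 2, 1 - a 0 - a 1 - a 2] = a := by
  rw [Fin.sum_univ_four] at ha
  have : 1 - a 0 - a 1 - a 2 = a 3 := by linear_combination -ha
  ext j
  fin_cases j <;> simp [this]

/-- Points on the same line through the centre of a camera have the same images. -/
theorem IsImage.of_collinear {C : Matrix (Fin 3) (Fin 4) K} {E : (Fin 3 → K) ≃ᵃ[K] (Fin 3 → K)}
    (hE : ∀ X, C *ᵥ homog X = E X) {X Y q : Fin 3 → K} {k : K} (hk : k ≠ 0)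
    (hXY : Y - E.symm 0 = k • (X - E.symm 0)) (hX : IsImage C X q) : IsImage C Y q := by
  obtain ⟨hq, c, hc, h⟩ := hX
  have hlin : ∀ Z, E.linear (Z - E.symm 0) = E Z := fun Z => by
    simpa using E.toAffineMap.linearMap_vsub Z (E.symm 0)
  refine ⟨hq, k * c, mul_ne_zero hk hc, ?_⟩
  rw [hE, ← hlin, hXY, map_smul, hlin, ← hE, h, smul_smul]

/-- The points `P₀, …, P₃` of a configuration span the space, so invariants exist. -/
theorem IsConfiguration.exists_hasInvariants {m : ℕ} {P : Fin 4 ⊕ Fin m → Fin 3 → K}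
    (hP : IsConfiguration P) : ∃ x, HasInvariants P x := by
  have htop : affineSpan K (Set.range fun j : Fin 4 => P (Sum.inl j)) = ⊤ :=
    hP.2.affineSpan_eq_top_iff_card_eq_finrank_add_one.mpr (by simp)
  let b : AffineBasis (Fin 4) K (Fin 3 → K) := ⟨_, hP.2, htop⟩
  refine ⟨fun ik => b.coord ik.2.castSucc (P (Sum.inr ik.1)), fun i => ?_⟩
  rw [affComb_eq_sum]
  have h := barycentric_eq (b.sum_coord_apply_eq_one (P (Sum.inr i)))
  exact (b.linear_combination_coord_eq_self (P (Sum.inr i))).symm.trans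
    (Finset.sum_congr rfl fun j _ => congrArg (· • _) (congrFun h j).symm)

/-- The effect of a perspectivity centred at the camera centre on a configuration that is
compatible with three images. -/
theorem perspectivity_mem_compatibleInvariants {m : ℕ} {C : Matrix (Fin 3) (Fin 4) K}
    {E : (Fin 3 → K) ≃ᵃ[K] (Fin 3 → K)} (hE : ∀ X, C *ᵥ homog X = E X)
    {P : Fin 4 ⊕ Fin m → Fin 3 → K} (hP : IsConfiguration P)
    {T₁ T₂ : (Fin 3 → K) ≃ᵃ[K] (Fin 3 → K)} {q q' q'' : Fin 4 ⊕ Fin m → Fin 3 → K}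
    (hq : AreImages C P T₁ T₂ q q' q'') {x : Fin m × Fin 3 → K} (hx : HasInvariants P x)
    (w : (Fin 3 → K) →ₗ[K] K) (hw : ∀ i, 1 + w (P i - E.symm 0) ≠ 0)
    (hw₁ : 1 + w (T₁.symm (E.symm 0) - E.symm 0) ≠ 0)
    (hw₂ : 1 + w ((T₁.trans T₂).symm (E.symm 0) - E.symm 0) ≠ 0) :
    (fun ik : Fin m × Fin 3 => x ik * (1 + w (P (Sum.inl ik.2.castSucc) - E.symm 0)) /
      (1 + w (P (Sum.inr ik.1) - E.symm 0))) ∈ compatibleInvariants C q q' q'' := by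
  set c := E.symm 0
  obtain ⟨S₁, hS₁⟩ := exists_affineEquiv_perspectivity c w T₁ hw₁
  -- The composite is corrected as a whole, since the perspectivity acts on the first scene; the new
  -- second deformation is then `S₁⁻¹` followed by `S₂`.
  obtain ⟨S₂, hS₂⟩ := exists_affineEquiv_perspectivity c w (T₁.trans T₂) hw₂
  refine ⟨fun i => perspectivity c w (P i), S₁, S₁.symm.trans S₂, ⟨fun i j hij => ?_, ?_⟩,
    fun i => ?_, fun i => ⟨?_, ?_, ?_⟩⟩
  · exact hP.1 (perspectivity_injOn c w (hw i) (hw j) hij)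
  · exact hP.2.perspectivity fun j => hw (Sum.inl j)
  · have hi := hx i
    rw [affComb_eq_sum] at hi
    have hwi := hw (Sum.inr i)
    have h := perspectivity_sum (fun j => hw (Sum.inl j))
      (sum_barycentric (x (i, 0)) (x (i, 1)) (x (i, 2))) (hi ▸ hwi)
    rw [← hi] at h
    change perspectivity c w (P (Sum.inr i)) = _
    rw [h.2, affComb_eq_sum]
    exact Finset.sum_congr rfl fun j _ => congrArg (· • _) (congrFun (barycentric_eq h.1) j).symm
  · exact (hq i).1.of_collinear hE (inv_ne_zero (hw i)) (perspectivity_sub c w (P i))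
  · exact (hq i).2.1.of_collinear hE (inv_ne_zero (hw i)) (hS₁ (P i) (hw i))
  · refine (hq i).2.2.of_collinear hE (inv_ne_zero (hw i)) ?_
    simpa using hS₂ (P i) (hw i)

theorem cross_eq_zero_of_eq_smul {u v : Fin 3 → K} {k : K} (h : v = k • u) : u ⨯₃ v = 0 := by
  rw [h, map_smul, cross_self, smul_zero]

theorem exists_deformedImageEqs {m : ℕ} {C : Matrix (Fin 3) (Fin 4) K}
    {E : (Fin 3 → K) ≃ᵃ[K] (Fin 3 → K)} (hE : ∀ X, C *ᵥ homog X = E X)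
    {P : Fin 4 ⊕ Fin m → Fin 3 → K} {T : (Fin 3 → K) ≃ᵃ[K] (Fin 3 → K)}
    {q r : Fin 4 ⊕ Fin m → Fin 3 → K} (hr : ∀ i, IsImage C (T (P i)) (r i)) {l : Fin 4 → K}
    {x : Fin m × Fin 3 → K} (hl : ∀ j, l j • q (Sum.inl j) = E (P (Sum.inl j)))
    (hx : ∀ i, scaledPoint q l x i = E (P (Sum.inr i))) :
    ∃ M : ℙ K (Matrix (Fin 3) (Fin 4) K), DeformedImageEqs q r M.rep l x := by
  -- Conjugation by `E` normalizes the camera to `[I; 0]`.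
  obtain ⟨N, hN⟩ := exists_mulVec_homog ((E.symm.trans T).trans E).toAffineMap
  choose hr0 k hk hrk using hr
  have hNE : ∀ i, N *ᵥ homog (E (P i)) = k i • r i := fun i => by
    rw [hN, ← hrk, hE]
    simp
  have hN0 : N ≠ 0 := by
    rintro rfl
    have := hNE (Sum.inl 0)
    rw [Matrix.zero_mulVec] at this
    exact smul_ne_zero (hk _) (hr0 _) this.symm
  refine ⟨Projectivization.mk K N hN0, ?_⟩
  obtain ⟨a, ha⟩ := Projectivization.exists_smul_eq_mk_rep K N hN0
  have hrep : ∀ i, r i ⨯₃ ((Projectivization.mk K N hN0).rep *ᵥ homog (E (P i))) = 0 := fun i =>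
    cross_eq_zero_of_eq_smul (k := a * k i) (by
      rw [← ha, Units.smul_def, Matrix.smul_mulVec, hNE, smul_smul])
  exact ⟨fun j => hl j ▸ hrep _, fun i => hx i ▸ hrep _⟩

theorem compatibleInvariants_subset_projectedInvariants {m : ℕ} {C : Matrix (Fin 3) (Fin 4) K}
    (hC : IsFiniteCamera C) (q q' q'' : Fin 4 ⊕ Fin m → Fin 3 → K) :
    compatibleInvariants C q q' q'' ⊆ projectedInvariants q q' q'' := by
  rintro x ⟨P, T₁, T₂, -, hx, hq⟩
  obtain ⟨E, hE⟩ := hC.exists_affineEquiv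
  choose _ k hk hqk using fun i => (hq i).1
  have hEP : ∀ i, k i • q i = E (P i) := fun i => by rw [← hqk, hE]
  have hs : ∀ i, scaledPoint q (fun j => k (Sum.inl j)) x i = E (P (Sum.inr i)) := fun i => by
    rw [hx i, scaledPoint]
    simp only [hEP]
    exact (map_affComb E.toAffineMap _ _ _ _).symm
  obtain ⟨M, hM⟩ := exists_deformedImageEqs hE (fun i => (hq i).2.1) (fun j => hEP _) hs
  obtain ⟨N, hN⟩ := exists_deformedImageEqs (T := T₁.trans T₂) hE (fun i => (hq i).2.2)
    (fun j => hEP _) hs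
  exact ⟨(M, N, _, fun j => (k (Sum.inl j))⁻¹, x),
    ⟨fun i => cross_eq_zero_of_eq_smul ((hs i).trans (hEP _).symm), hM, hN,
      fun j => mul_inv_cancel₀ (hk _)⟩, rfl⟩

end Cameras

/-! ### The one-parameter family of ambiguous invariants -/

section Ambiguity

variable {K : Type*} [Field K]

theorem infinite_setOf_forall_one_add_mul_ne_zero [Infinite K] {ι : Type*} [Finite ι] (b : ι → K) :
    {s : K | ∀ i, 1 + s * b i ≠ 0}.Infinite := by
  have hfin : (⋃ i, {s : K | 1 + s * b i = 0}).Finite :=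
    Set.finite_iUnion fun i => Set.Subsingleton.finite fun s hs t ht => by
      have hb : b i ≠ 0 := fun h => by simp [h] at hs
      rw [Set.mem_ofPred_eq] at hs ht
      exact mul_right_cancel₀ hb (by linear_combination hs - ht)
  convert hfin.infinite_compl using 1
  ext s
  simp

/-- The triple of invariants of each single point is undetermined. -/
theorem infinite_image_compatibleInvariants [Infinite K] {m : ℕ} {C : Matrix (Fin 3) (Fin 4) K}
    (hC : IsFiniteCamera C) {P : Fin 4 ⊕ Fin m → Fin 3 → K} (hP : IsConfiguration P)
    {T₁ T₂ : (Fin 3 → K) ≃ᵃ[K] (Fin 3 → K)} {q q' q'' : Fin 4 ⊕ Fin m → Fin 3 → K}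
    (hq : AreImages C P T₁ T₂ q q' q'') (i : Fin m) :
    ((fun x : Fin m × Fin 3 → K => fun k : Fin 3 => x (i, k)) ''
      compatibleInvariants C q q' q'').Infinite := by
  obtain ⟨E, hE⟩ := hC.exists_affineEquiv
  obtain ⟨x, hx⟩ := hP.exists_hasInvariants
  set c := E.symm 0
  set a : Fin 4 → K := ![x (i, 0), x (i, 1), x (i, 2), 1 - x (i, 0) - x (i, 1) - x (i, 2)]
  have hsum : ∑ j, a j = 1 := sum_barycentric _ _ _
  have hPi : P (Sum.inr i) = ∑ j, a j • P (Sum.inl j) := (hx i).trans (affComb_eq_sum _ _ _ _)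
  -- Here `j` may be 3, the coordinate missing from the triple; it is recovered below because the
  -- coordinates sum to 1.
  obtain ⟨j, -, hj⟩ : ∃ j ∈ Finset.univ, a j ≠ 0 :=
    Finset.exists_ne_zero_of_sum_ne_zero (by rw [hsum]; exact one_ne_zero)
  obtain ⟨d, hd⟩ : ∃ d, P (Sum.inl j) d ≠ P (Sum.inr i) d :=
    Function.ne_iff.mp (hP.1.ne Sum.inl_ne_inr)
  -- All points that the plane sent to infinity must avoid.
  let pts : (Fin 4 ⊕ Fin m) ⊕ Fin 2 → Fin 3 → K :=
    Sum.elim P ![T₁.symm c, (T₁.trans T₂).symm c]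
  let w : K → (Fin 3 → K) →ₗ[K] K := fun s => s • LinearMap.proj d
  have hws : ∀ s X, w s (X - c) = s * (X d - c d) := fun s X => rfl
  let h : K → Fin 4 ⊕ Fin m → K := fun s k => 1 + w s (P k - c)
  let g : K → Fin 4 → K := fun s k => a k * h s (Sum.inl k) / h s (Sum.inr i)
  have hinf := infinite_setOf_forall_one_add_mul_ne_zero fun k => pts k d - c d
  refine (hinf.image (f := fun s (k : Fin 3) => g s k.castSucc) ?_).mono ?_
  · intro s hs t ht hst
    have hs0 : h s (Sum.inr i) ≠ 0 := hs (Sum.inl (Sum.inr i))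
    have ht0 : h t (Sum.inr i) ≠ 0 := ht (Sum.inl (Sum.inr i))
    have hg : ∀ r, h r (Sum.inr i) ≠ 0 → ∑ k, g r k = 1 := fun r hr => by
      have hw : ∑ k, a k * h r (Sum.inl k) = h r (Sum.inr i) := by
        have hsub : ∑ k, a k * (P (Sum.inl k) d - c d) = P (Sum.inr i) d - c d := by
          simp only [mul_sub, Finset.sum_sub_distrib, ← Finset.sum_mul, hsum, one_mul, hPi,
            Finset.sum_apply, Pi.smul_apply, smul_eq_mul]
        simp only [h, hws, mul_add, mul_one, Finset.sum_add_distrib, hsum, ← hsub, Finset.mul_sum]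
        exact congrArg _ (Finset.sum_congr rfl fun k _ => by ring)
      rw [← Finset.sum_div, hw, div_self hr]
    have hgst : g s j = g t j := by
      rw [← barycentric_eq (hg s hs0), ← barycentric_eq (hg t ht0)]
      have h0 : g s 0 = g t 0 := congrFun hst 0
      have h1 : g s 1 = g t 1 := congrFun hst 1
      have h2 : g s 2 = g t 2 := congrFun hst 2
      rw [h0, h1, h2]
    have hcross := (div_eq_div_iff hs0 ht0).mp hgst
    simp only [h, hws] at hcross
    -- The first two factors form the determinant of the Möbius function `s ↦ g s j`.
    have : a j * (P (Sum.inl j) d - P (Sum.inr i) d) * (s - t) = 0 := by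
      linear_combination hcross
    exact sub_eq_zero.mp ((mul_eq_zero.mp this).resolve_left (mul_ne_zero hj (sub_ne_zero.mpr hd)))
  · rintro _ ⟨s, hs, rfl⟩
    refine ⟨_, perspectivity_mem_compatibleInvariants hE hP hq hx (w s)
      (fun k => hs (Sum.inl k)) (hs (Sum.inr 0)) (hs (Sum.inr 1)), ?_⟩
    ext k
    fin_cases k <;> rfl

end Ambiguity

theorem mainTheorem6 {K : Type*} [RCLike K] (m : ℕ) (hm : 1 ≤ m)
    (C : Matrix (Fin 3) (Fin 4) K) (hC : IsFiniteCamera C)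
    (P : Fin 4 ⊕ Fin m → Fin 3 → K) (hP : IsConfiguration P)
    (T₁ T₂ : (Fin 3 → K) ≃ᵃ[K] (Fin 3 → K))
    (q q' q'' : Fin 4 ⊕ Fin m → Fin 3 → K)
    (hq : AreImages C P T₁ T₂ q q' q'') :
    (compatibleInvariants C q q' q'').Infinite ∧
    (∀ i : Fin m, ((fun x : Fin m × Fin 3 → K => fun k : Fin 3 => x (i, k)) ''
      compatibleInvariants C q q' q'').Infinite) ∧
    0 < zariskiDim (compatibleInvariants C q q' q'') ∧
    0 < zariskiDim (projectedInvariants q q' q'') := by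
  have : Infinite K := Infinite.of_injective _ (Nat.cast_injective (R := K))
  have hi := infinite_image_compatibleInvariants hC hP hq
  have h := (hi ⟨0, hm⟩).of_image
  exact ⟨h, hi, zariskiDim_pos_of_infinite h,
    zariskiDim_pos_of_infinite (h.mono (compatibleInvariants_subset_projectedInvariants hC _ _ _))⟩
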